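/- Let $0 \le m \le n$ be integers, and for $0\le k\le n$ let $G(n,k)$ be the Grassmannian of $k$-dimensional linear subspaces of $\mathbb{R}^n$, with $\gamma_{n,k}$ the $O(n)$-invariant Borel probability measure on $G(n,k)$. Let $\dim$ denote Hausdorff dimension. If $A \subset \mathbb{R}^n$ is a Borel set with $\dim A > m$, then for every $x \in \mathbb{R}^n$, $$\dim\bigl(A \cap (V+x)\bigr) \le \dim A - m \quad \text{for } \gamma_{n,n-m}\text{-almost every } V \in G(n,n-m).$$ -/

import Mathlib

open Set MeasureTheory Topology

noncomputable section

/-- The Grassmannian `G(n,k)` of `k`-dimensional linear subspaces of Euclidean `n`-space. -/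
def Grassmann (n k : ℕ) : Type :=
  {V : Submodule ℝ (EuclideanSpace ℝ (Fin n)) // Module.finrank ℝ V = k}

namespace Grassmann

variable {n k : ℕ}

/-- The orthogonal projection of `ℝⁿ` onto `V`, as an operator on `ℝⁿ`. -/
def proj (V : Grassmann n k) : EuclideanSpace ℝ (Fin n) →L[ℝ] EuclideanSpace ℝ (Fin n) :=
  V.1.starProjection

theorem proj_injective :
    Function.Injective (proj : Grassmann n k → _) := by
  intro V W h
  exact Subtype.ext (Submodule.starProjection_inj.mp h)

/-- The usual metric `d(V,W) = ‖P_V - P_W‖` on `G(n,k)`. -/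
instance : MetricSpace (Grassmann n k) := MetricSpace.induced proj proj_injective inferInstance

/-- The Borel σ-algebra of `G(n,k)`. -/
instance : MeasurableSpace (Grassmann n k) := borel _

instance : BorelSpace (Grassmann n k) := ⟨rfl⟩

end Grassmann

/-- The orthogonal group `O(n)`: linear operators `g` on `ℝⁿ` with `g* g = g g* = 1`, with the
topology given by the operator norm. -/
abbrev OrthGroup (n : ℕ) : Type :=
  unitary (EuclideanSpace ℝ (Fin n) →L[ℝ] EuclideanSpace ℝ (Fin n))

namespace OrthGroup

variable {n k : ℕ}

instance : ContinuousStar (EuclideanSpace ℝ (Fin n) →L[ℝ] EuclideanSpace ℝ (Fin n)) :=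
  ⟨(ContinuousLinearMap.adjoint (𝕜 := ℝ) (E := EuclideanSpace ℝ (Fin n))
    (F := EuclideanSpace ℝ (Fin n))).continuous⟩

instance : CompactSpace (OrthGroup n) := by
  refine (isCompact_iff_compactSpace (s := (unitary (EuclideanSpace ℝ (Fin n) →L[ℝ]
    EuclideanSpace ℝ (Fin n)) : Set (EuclideanSpace ℝ (Fin n) →L[ℝ]
      EuclideanSpace ℝ (Fin n))))).mp ?_
  haveI : ProperSpace (EuclideanSpace ℝ (Fin n) →L[ℝ] EuclideanSpace ℝ (Fin n)) :=
    FiniteDimensional.proper ℝ _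
  refine Metric.isCompact_of_isClosed_isBounded isClosed_unitary ?_
  · refine (Metric.isBounded_closedBall (x := 0) (r := 1)).subset fun g hg => ?_
    rw [mem_closedBall_zero_iff]
    refine ContinuousLinearMap.opNorm_le_bound _ zero_le_one fun x => ?_
    have := (Unitary.linearIsometryEquiv ⟨g, hg⟩).norm_map x
    rw [one_mul]
    exact this.le

/-- The Haar measure on `O(n)`, with total mass one. -/
def haar (n : ℕ) : Measure (OrthGroup n) := Measure.haarMeasure ⊤

instance : IsProbabilityMeasure (haar n) :=
  ⟨Measure.haarMeasure_self (K₀ := (⊤ : TopologicalSpace.PositiveCompacts (OrthGroup n)))⟩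

/-- The action of `O(n)` on `G(n,k)`: `g` sends `V` to its image `g(V)`. -/
def act (g : OrthGroup n) (V : Grassmann n k) : Grassmann n k :=
  ⟨V.1.map (Unitary.linearIsometryEquiv g).toLinearEquiv.toLinearMap, by
    rw [LinearEquiv.finrank_map_eq]; exact V.2⟩

theorem proj_act (g : OrthGroup n) (V : Grassmann n k) :
    (act g V).proj = (g : EuclideanSpace ℝ (Fin n) →L[ℝ] EuclideanSpace ℝ (Fin n)) * V.proj *
      star (g : EuclideanSpace ℝ (Fin n) →L[ℝ] EuclideanSpace ℝ (Fin n)) := by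
  ext1 x
  exact Submodule.starProjection_map_apply (Unitary.linearIsometryEquiv g) V.1 x

theorem continuous_act (V : Grassmann n k) : Continuous fun g : OrthGroup n => act g V := by
  have : IsInducing (Grassmann.proj : Grassmann n k → _) := ⟨rfl⟩
  rw [this.continuous_iff]
  have h : (Grassmann.proj ∘ fun g : OrthGroup n => act g V) = fun g : OrthGroup n =>
      (g : EuclideanSpace ℝ (Fin n) →L[ℝ] EuclideanSpace ℝ (Fin n)) * V.proj *
      star (g : EuclideanSpace ℝ (Fin n) →L[ℝ] EuclideanSpace ℝ (Fin n)) :=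
    funext fun g => proj_act g V
  rw [h]
  fun_prop

end OrthGroup

namespace Grassmann

/-- The coordinate `k`-plane spanned by the first `k` standard basis vectors of `ℝⁿ`. -/
def coordPlane (n k : ℕ) (hk : k ≤ n) : Grassmann n k :=
  ⟨Submodule.span ℝ (range fun i : Fin k => EuclideanSpace.single (Fin.castLE hk i) (1 : ℝ)), by
    have h := ((EuclideanSpace.basisFun (Fin n) ℝ).orthonormal.linearIndependent).comp
      (Fin.castLE hk) (Fin.castLE_injective hk)
    rw [show (fun i : Fin k => EuclideanSpace.single (Fin.castLE hk i) (1 : ℝ)) =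
      (EuclideanSpace.basisFun (Fin n) ℝ) ∘ Fin.castLE hk from
        funext fun i => (EuclideanSpace.basisFun_apply (Fin n) ℝ _).symm]
    exact (finrank_span_eq_card h).trans (Fintype.card_fin k)⟩

/-- The measure `γ_{n,k}` on `G(n,k)`: the image of the normalised Haar measure of `O(n)` under
`g ↦ g(V₀)`, where `V₀` is a coordinate `k`-plane. It is the unique `O(n)`-invariant Borel
probability measure on `G(n,k)`. -/
def gamma (n k : ℕ) (hk : k ≤ n) : Measure (Grassmann n k) :=
  (OrthGroup.haar n).map fun g => OrthGroup.act g (coordPlane n k hk)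

/-- The map defining `gamma` is measurable, so `gamma` has total mass one. -/
instance (n k : ℕ) (hk : k ≤ n) : IsProbabilityMeasure (gamma n k hk) :=
  Measure.isProbabilityMeasure_map (OrthGroup.continuous_act _).measurable.aemeasurable

end Grassmann

end

open Filter
open scoped ENNReal NNReal MeasureTheory

namespace Grassmann

variable {n k : ℕ}

/-! Translation reduces to `x = 0`. The key estimate (`exists_gamma_tube_le`) is that the planes of
codimension `m` passing within `r` of a point `y`, `‖y‖ ≥ δ`, have measure at most `C r ^ m`. If
`μH[t] A = 0` with `t > m` and `A` avoids a ball about the origin, cover `A` by sets `E i` with `∑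
diam (E i) ^ t` small. Integrating over `V` the sum of `diam (E i) ^ (t - m)` over those `E i` that
`V` meets within `A` costs at most `C ∑ diam (E i) ^ t`, so Fatou along finer covers gives `μH[t -
m] (A ∩ V) = 0` for almost every `V`. Finally exhaust `A \ {0}` and let `t` decrease to `dimH A`. -/

theorem continuous_proj : Continuous (proj : Grassmann n k → _) :=
  continuous_induced_dom

/-- The set of planes `V` at distance at most `r` from the point `y`. -/
def tube (k : ℕ) (y : EuclideanSpace ℝ (Fin n)) (r : ℝ) : Set (Grassmann n k) :=
  {V | ‖y - V.proj y‖ ≤ r}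

theorem isClosed_tube (y : EuclideanSpace ℝ (Fin n)) (r : ℝ) : IsClosed (tube k y r) := by
  have h : Continuous fun V : Grassmann n k => V.proj y := continuous_proj.clm_apply continuous_const
  exact isClosed_le (by fun_prop) continuous_const

theorem mem_tube_of_dist_le {V : Grassmann n k} {y z : EuclideanSpace ℝ (Fin n)} {r : ℝ}
    (hz : z ∈ V.1) (h : dist y z ≤ r) : V ∈ tube k y r := by
  refine le_trans ?_ h
  rw [proj, Submodule.starProjection_minimal, dist_eq_norm]
  exact ciInf_le ⟨0, by rintro _ ⟨w, rfl⟩; exact norm_nonneg _⟩ (⟨z, hz⟩ : V.1)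

theorem smul_mem_tube_iff {V : Grassmann n k} {y : EuclideanSpace ℝ (Fin n)} {r c : ℝ}
    (hc : 0 < c) : V ∈ tube k (c • y) (c * r) ↔ V ∈ tube k y r := by
  simp only [tube, mem_ofPred_eq, map_smul, ← smul_sub, norm_smul, Real.norm_of_nonneg hc.le]
  exact mul_le_mul_iff_right₀ hc

theorem act_mem_tube_iff (g : OrthGroup n) (V : Grassmann n k) (y : EuclideanSpace ℝ (Fin n))
    (r : ℝ) : OrthGroup.act g V ∈ tube k y r ↔
      V ∈ tube k ((Unitary.linearIsometryEquiv g).symm y) r := by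
  have h : (OrthGroup.act g V).proj y = Unitary.linearIsometryEquiv g
      (V.proj ((Unitary.linearIsometryEquiv g).symm y)) :=
    Submodule.starProjection_map_apply (Unitary.linearIsometryEquiv g) V.1 y
  simp only [tube, mem_ofPred_eq]
  rw [h, ← (Unitary.linearIsometryEquiv g).norm_map ((Unitary.linearIsometryEquiv g).symm y - _),
    map_sub, LinearIsometryEquiv.apply_symm_apply]

/-! ### Orthogonal invariance of tube measures -/

theorem _root_.OrthGroup.act_mul (g h : OrthGroup n) (V : Grassmann n k) :
    OrthGroup.act (g * h) V = OrthGroup.act g (OrthGroup.act h V) := by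
  apply proj_injective
  simp only [OrthGroup.proj_act, Submonoid.coe_mul, star_mul, mul_assoc]

theorem gamma_tube (hk : k ≤ n) (y : EuclideanSpace ℝ (Fin n)) (r : ℝ) :
    gamma n k hk (tube k y r) =
      OrthGroup.haar n {g | OrthGroup.act g (coordPlane n k hk) ∈ tube k y r} :=
  Measure.map_apply (OrthGroup.continuous_act _).measurable (isClosed_tube y r).measurableSet

theorem gamma_tube_map (hk : k ≤ n) (u : OrthGroup n) (y : EuclideanSpace ℝ (Fin n)) (r : ℝ) :
    gamma n k hk (tube k (Unitary.linearIsometryEquiv u y) r) = gamma n k hk (tube k y r) := by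
  have : (OrthGroup.haar n).IsMulLeftInvariant := by unfold OrthGroup.haar; infer_instance
  rw [gamma_tube, gamma_tube, ← measure_preimage_mul (OrthGroup.haar n) u]
  congr 1
  ext g
  rw [mem_preimage, mem_ofPred_eq, mem_ofPred_eq, OrthGroup.act_mul, act_mem_tube_iff,
    LinearIsometryEquiv.symm_apply_apply]

theorem gamma_tube_eq_of_norm_eq (hk : k ≤ n) {y z : EuclideanSpace ℝ (Fin n)} (h : ‖y‖ = ‖z‖)
    (r : ℝ) : gamma n k hk (tube k y r) = gamma n k hk (tube k z r) := by
  -- The reflection in the hyperplane orthogonal to `y - z` swaps `y` and `z`.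
  rw [← gamma_tube_map hk (Unitary.linearIsometryEquiv.symm (Submodule.span ℝ {y - z})ᗮ.reflection) y,
    MulEquiv.apply_symm_apply, Submodule.reflection_sub h]

/-- Shrinking `y` to norm `‖z‖` only decreases its distance to each plane, and the measure depends
on the norm alone. -/
theorem gamma_tube_le_of_norm_le (hk : k ≤ n) {y z : EuclideanSpace ℝ (Fin n)} (hz : z ≠ 0)
    (h : ‖z‖ ≤ ‖y‖) {r : ℝ} (hr : 0 ≤ r) :
    gamma n k hk (tube k y r) ≤ gamma n k hk (tube k z r) := by
  have hz' : 0 < ‖z‖ := norm_pos_iff.mpr hz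
  have hy' : 0 < ‖y‖ := hz'.trans_le h
  have hc : 0 < ‖z‖ / ‖y‖ := div_pos hz' hy'
  have hn : ‖(‖z‖ / ‖y‖) • y‖ = ‖z‖ := by
    rw [norm_smul, Real.norm_of_nonneg hc.le, div_mul_cancel₀ _ hy'.ne']
  rw [← gamma_tube_eq_of_norm_eq hk hn]
  refine measure_mono fun V hV => ?_
  have h1 := (smul_mem_tube_iff hc).mpr hV
  exact le_trans h1 (mul_le_of_le_one_left hr ((div_le_one hy').mpr h))

/-! ### The tube estimate -/

theorem apply_eq_zero_of_mem_coordPlane (hk : k ≤ n) {z : EuclideanSpace ℝ (Fin n)}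
    (hz : z ∈ (coordPlane n k hk).1) {i : Fin n} (hi : k ≤ i) : z i = 0 := by
  refine Submodule.span_induction (p := fun z _ => z i = 0) ?_ rfl ?_ ?_ hz
  · rintro _ ⟨j, rfl⟩
    have : i ≠ Fin.castLE hk j := by
      intro h
      have := congrArg Fin.val h
      simp at this
      omega
    simp [this]
  · intro a b _ _ ha hb
    simp [ha, hb]
  · intro c a _ ha
    simp [ha]

/-- The set lies in a box: `n - m` coordinates are bounded by `1`, the `m` coordinates normal to the
plane by `r`. -/
theorem volume_ball_inter_tube_le {m : ℕ} (hm : m ≤ n) (r : ℝ) :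
    volume {y : EuclideanSpace ℝ (Fin n) | y ∈ Metric.ball 0 1 ∧
      coordPlane n (n - m) (Nat.sub_le n m) ∈ tube (n - m) y r} ≤
      2 ^ n * ENNReal.ofReal r ^ m := by
  set b : Fin n → ℝ := fun i => if (i : ℕ) < n - m then 1 else r with hb
  have hsub : {y : EuclideanSpace ℝ (Fin n) | y ∈ Metric.ball 0 1 ∧
      coordPlane n (n - m) (Nat.sub_le n m) ∈ tube (n - m) y r} ⊆
      WithLp.ofLp ⁻¹' Icc (-b) b := by
    rintro y ⟨hy, hV⟩
    rw [mem_ball_zero_iff] at hy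
    have key : ∀ i, |y i| ≤ b i := by
      intro i
      by_cases hi : (i : ℕ) < n - m
      · simp only [hb, hi, if_true]
        exact (PiLp.norm_apply_le y i).trans hy.le
      · simp only [hb, hi, if_false]
        have h0 := apply_eq_zero_of_mem_coordPlane (Nat.sub_le n m) (i := i)
          (Submodule.starProjection_apply_mem (coordPlane n (n - m) (Nat.sub_le n m)).1 y)
          (not_lt.mp hi)
        have h1 := PiLp.norm_apply_le (y - (coordPlane n (n - m) (Nat.sub_le n m)).proj y) i
        rw [PiLp.sub_apply, proj, h0, sub_zero] at h1
        exact h1.trans hV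
    exact ⟨fun i => (abs_le.mp (key i)).1, fun i => (abs_le.mp (key i)).2⟩
  refine (measure_mono hsub).trans ?_
  rw [(PiLp.volume_preserving_ofLp (Fin n)).measure_preimage measurableSet_Icc.nullMeasurableSet,
    Real.volume_Icc_pi]
  have h2 : ∀ i, ENNReal.ofReal (b i - (-b) i) = 2 * ENNReal.ofReal (b i) := by
    intro i
    rw [Pi.neg_apply, sub_neg_eq_add, ← two_mul, ENNReal.ofReal_mul zero_le_two, ENNReal.ofReal_ofNat]
  have h3 : ∀ i, ENNReal.ofReal (b i) = if (i : ℕ) < n - m then 1 else ENNReal.ofReal r := by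
    intro i
    simp only [hb]
    split_ifs <;> simp
  simp only [h2, Finset.prod_mul_distrib, Finset.prod_const, Finset.card_univ, Fintype.card_fin]
  gcongr
  simp only [h3]
  rw [Fin.prod_univ_eq_prod_range (fun i => if i < n - m then 1 else ENNReal.ofReal r) n]
  obtain ⟨d, rfl⟩ := Nat.exists_eq_add_of_le' hm
  rw [Nat.add_sub_cancel, Finset.prod_range_add]
  simp +contextual [Finset.prod_eq_one]

/-- Unit vectors have the smallest tube measure among nonzero points of the ball, so average over
the ball. Fubini swaps point and rotation; rotation invariance of Lebesgue measure then reduces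
every slice to the coordinate plane. -/
theorem volume_ball_mul_gamma_tube_le {m : ℕ} (hm : m ≤ n) {y : EuclideanSpace ℝ (Fin n)}
    (hy : ‖y‖ = 1) {r : ℝ} (hr : 0 ≤ r) :
    volume (Metric.ball (0 : EuclideanSpace ℝ (Fin n)) 1) *
      gamma n (n - m) (Nat.sub_le n m) (tube (n - m) y r) ≤ 2 ^ n * ENNReal.ofReal r ^ m := by
  set V₀ := coordPlane n (n - m) (Nat.sub_le n m)
  set ν := (volume : Measure (EuclideanSpace ℝ (Fin n))).restrict (Metric.ball 0 1) with hν
  let S : Set (EuclideanSpace ℝ (Fin n) × OrthGroup n) :=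
    {p | OrthGroup.act p.2 V₀ ∈ tube (n - m) p.1 r}
  have hS : MeasurableSet S := by
    have h : Continuous fun p : EuclideanSpace ℝ (Fin n) × OrthGroup n =>
        (OrthGroup.act p.2 V₀).proj p.1 :=
      (continuous_proj.comp ((OrthGroup.continuous_act V₀).comp continuous_snd)).clm_apply
        continuous_fst
    exact (isClosed_le (continuous_fst.sub h).norm continuous_const).measurableSet
  have hne : ∀ᵐ z ∂ν, z ≠ 0 ∧ z ∈ Metric.ball (0 : EuclideanSpace ℝ (Fin n)) 1 := by
    have : Nontrivial (EuclideanSpace ℝ (Fin n)) := ⟨y, 0, by rintro rfl; simp at hy⟩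
    exact (ae_restrict_of_ae (Measure.ae_ne volume 0)).and (ae_restrict_mem measurableSet_ball)
  calc volume (Metric.ball (0 : EuclideanSpace ℝ (Fin n)) 1) *
        gamma n (n - m) (Nat.sub_le n m) (tube (n - m) y r)
      = ∫⁻ _, gamma n (n - m) (Nat.sub_le n m) (tube (n - m) y r) ∂ν := by
        rw [lintegral_const, hν, Measure.restrict_apply_univ, mul_comm]
    _ ≤ ∫⁻ z, OrthGroup.haar n (Prod.mk z ⁻¹' S) ∂ν := by
        refine lintegral_mono_ae ?_
        filter_upwards [hne] with z hz
        refine (gamma_tube_le_of_norm_le _ hz.1 ?_ hr).trans_eq (gamma_tube _ z r)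
        rw [hy]
        exact (mem_ball_zero_iff.mp hz.2).le
    _ = ∫⁻ g, ν ((fun z => (z, g)) ⁻¹' S) ∂(OrthGroup.haar n) := by
        rw [← Measure.prod_apply hS, Measure.prod_apply_symm hS]
    _ ≤ ∫⁻ _, 2 ^ n * ENNReal.ofReal r ^ m ∂(OrthGroup.haar n) := by
        refine lintegral_mono fun g => ?_
        refine le_trans ?_ (volume_ball_inter_tube_le hm r)
        rw [hν, Measure.restrict_apply (measurable_prodMk_right hS),
          ← ((Unitary.linearIsometryEquiv g).measurePreserving).measure_preimage_equiv
            (f := (Unitary.linearIsometryEquiv g).toMeasurableEquiv)]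
        refine measure_mono fun z hz => ⟨?_, ?_⟩
        · have := hz.2
          simpa using this
        · have h1 := (act_mem_tube_iff g V₀ _ r).mp hz.1
          simpa using h1
    _ = 2 ^ n * ENNReal.ofReal r ^ m := by simp

/-- The planes at distance at most `r` from a point away from the origin have measure of order
at most `r ^ m`, `m` being the codimension. -/
theorem exists_gamma_tube_le {m : ℕ} (hm : m ≤ n) {δ : ℝ} (hδ : 0 < δ) :
    ∃ C : ℝ≥0∞, C ≠ ∞ ∧ ∀ y : EuclideanSpace ℝ (Fin n), δ ≤ ‖y‖ → ∀ r : ℝ, 0 ≤ r →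
      gamma n (n - m) (Nat.sub_le n m) (tube (n - m) y r) ≤ C * ENNReal.ofReal r ^ m := by
  set B := volume (Metric.ball (0 : EuclideanSpace ℝ (Fin n)) 1)
  have hB : B ≠ 0 := (Metric.measure_ball_pos _ _ one_pos).ne'
  have hB' : B ≠ ∞ := measure_ball_lt_top.ne
  -- The last factor comes from rescaling `y` to the unit sphere, which turns `r` into `r / ‖y‖ ≤ r
  -- / δ`.
  refine ⟨B⁻¹ * 2 ^ n * ENNReal.ofReal δ⁻¹ ^ m, ?_, fun y hy r hr => ?_⟩
  · finiteness
  have hy0 : 0 < ‖y‖ := hδ.trans_le hy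
  have hn : ‖‖y‖⁻¹ • y‖ = 1 := by
    rw [norm_smul, norm_inv, norm_norm, inv_mul_cancel₀ hy0.ne']
  have hsub : tube (n - m) y r ⊆ tube (n - m) (‖y‖⁻¹ • y) (δ⁻¹ * r) := fun V hV =>
    le_trans ((smul_mem_tube_iff (inv_pos.mpr hy0)).mpr hV)
      (mul_le_mul_of_nonneg_right (inv_anti₀ hδ hy) hr)
  have h1 := volume_ball_mul_gamma_tube_le hm hn (mul_nonneg (inv_nonneg.mpr hδ.le) hr)
  rw [ENNReal.ofReal_mul (inv_nonneg.mpr hδ.le), mul_pow] at h1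
  refine (measure_mono hsub).trans ?_
  calc _ = B⁻¹ * (B * gamma n (n - m) (Nat.sub_le n m)
        (tube (n - m) (‖y‖⁻¹ • y) (δ⁻¹ * r))) := by
        rw [← mul_assoc, ENNReal.inv_mul_cancel hB hB', one_mul]
    _ ≤ B⁻¹ * (2 ^ n * (ENNReal.ofReal δ⁻¹ ^ m * ENNReal.ofReal r ^ m)) := mul_le_mul_right h1 _
    _ = _ := by ring

end Grassmann

/-! ### Covers and integration over the Grassmannian -/

theorem exists_cover_of_hausdorffMeasure_eq_zero {X : Type*} [EMetricSpace X] [MeasurableSpace X]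
    [BorelSpace X] {s : Set X} {d : ℝ} (hd : 0 < d) (h : μH[d] s = 0) {ε : ℝ≥0∞} (hε : 0 < ε) :
    ∃ t : ℕ → Set X, s ⊆ ⋃ i, t i ∧ (∀ i, Metric.ediam (t i) ≤ ε) ∧
      ∑' i, Metric.ediam (t i) ^ d < ε := by
  rw [Measure.hausdorffMeasure_apply] at h
  simp only [ENNReal.iSup_eq_zero] at h
  have h1 := (h ε hε).trans_lt hε
  simp only [iInf_lt_iff] at h1
  obtain ⟨t, ht, htd, hlt⟩ := h1
  refine ⟨t, ht, htd, lt_of_le_of_lt (ENNReal.tsum_le_tsum fun i => ?_) hlt⟩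
  -- Empty sets are left out of the defining sum; they add `0 ^ d = 0` because `d > 0`.
  rcases (t i).eq_empty_or_nonempty with h0 | h0
  · simp [h0, hd]
  · simp [h0]

namespace Grassmann

variable {n : ℕ}

theorem ae_hausdorffMeasure_inter_eq_zero {m : ℕ} (hm : m ≤ n) {A : Set (EuclideanSpace ℝ (Fin n))}
    {δ : ℝ} (hδ : 0 < δ) (hA : ∀ y ∈ A, δ ≤ ‖y‖) {t : ℝ} (ht : m < t) (h : μH[t] A = 0) :
    ∀ᵐ V ∂(gamma n (n - m) (Nat.sub_le n m)),
      μH[t - m] (A ∩ (V.1 : Set (EuclideanSpace ℝ (Fin n)))) = 0 := by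
  obtain ⟨C, hC, hCle⟩ := exists_gamma_tube_le (n := n) hm hδ
  have ht0 : 0 < t := (Nat.cast_nonneg m).trans_lt ht
  have htm : 0 < t - m := sub_pos.mpr ht
  have hcov : ∀ N : ℕ, ∃ E : ℕ → Set (EuclideanSpace ℝ (Fin n)), A ⊆ ⋃ i, E i ∧
      (∀ i, Metric.ediam (E i) ≤ (N + 1 : ℝ≥0∞)⁻¹) ∧
      ∑' i, Metric.ediam (E i) ^ t < (N + 1 : ℝ≥0∞)⁻¹ := fun N =>
    exists_cover_of_hausdorffMeasure_eq_zero ht0 h (by simp)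
  choose E hAE hEd hEs using hcov
  -- Tube centres are taken in `A`, so that `δ ≤ ‖y‖` applies.
  have hpt : ∀ N i, ∃ y, (A ∩ E N i).Nonempty → y ∈ A ∩ E N i := fun N i => by
    by_cases hne : (A ∩ E N i).Nonempty
    · exact ⟨hne.some, fun _ => hne.some_mem⟩
    · exact ⟨0, fun h => absurd h hne⟩
  choose y hy using hpt
  have hfin : ∀ N i, Metric.ediam (E N i) ≠ ∞ := fun N i =>
    ((hEd N i).trans_lt (by simp)).ne
  classical
  -- `T N i` contains every plane that meets `A ∩ E N i`, so `f N V` below dominates the covering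
  -- sum for `A ∩ V`.
  let T : ℕ → ℕ → Set (Grassmann n (n - m)) := fun N i =>
    if (A ∩ E N i).Nonempty then tube (n - m) (y N i) (Metric.ediam (E N i)).toReal else ∅
  have hTm : ∀ N i, MeasurableSet (T N i) := fun N i => by
    simp only [T]
    split_ifs
    exacts [(isClosed_tube _ _).measurableSet, MeasurableSet.empty]
  have hTγ : ∀ N i, gamma n (n - m) (Nat.sub_le n m) (T N i) ≤ C * Metric.ediam (E N i) ^ m := by
    intro N i
    simp only [T]
    split_ifs with hne
    · refine (hCle _ (hA _ (hy N i hne).1) _ ENNReal.toReal_nonneg).trans_eq ?_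
      rw [ENNReal.ofReal_toReal (hfin N i)]
    · simp
  let f : ℕ → Grassmann n (n - m) → ℝ≥0∞ := fun N V =>
    ∑' i, (T N i).indicator (fun _ => Metric.ediam (E N i) ^ (t - m)) V
  have hfm : ∀ N, Measurable (f N) := fun N =>
    Measurable.tsum fun i => measurable_const.indicator (hTm N i)
  have hfi : ∀ N, ∫⁻ V, f N V ∂(gamma n (n - m) (Nat.sub_le n m)) ≤ C * (N + 1 : ℝ≥0∞)⁻¹ := by
    intro N
    rw [lintegral_tsum fun i => (measurable_const.indicator (hTm N i)).aemeasurable]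
    calc _ ≤ ∑' i, C * Metric.ediam (E N i) ^ t := by
          refine ENNReal.tsum_le_tsum fun i => ?_
          rw [lintegral_indicator_const (hTm N i)]
          calc _ ≤ Metric.ediam (E N i) ^ (t - m) * (C * Metric.ediam (E N i) ^ m) := by
                gcongr
                exact hTγ N i
            _ = C * Metric.ediam (E N i) ^ t := by
                rw [mul_left_comm, ← ENNReal.rpow_natCast,
                  ← ENNReal.rpow_add_of_nonneg _ _ htm.le (Nat.cast_nonneg m), sub_add_cancel]
      _ = C * ∑' i, Metric.ediam (E N i) ^ t := ENNReal.tsum_mul_left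
      _ ≤ _ := by
          gcongr
          exact (hEs N).le
  have hlim : Tendsto (fun N : ℕ => (N + 1 : ℝ≥0∞)⁻¹) atTop (𝓝 0) := by
    have := (tendsto_add_atTop_iff_nat 1).mpr ENNReal.tendsto_inv_nat_nhds_zero
    simpa using this
  -- Fatou: the integrals of `f N` tend to zero.
  have hint : ∫⁻ V, liminf (fun N => f N V) atTop ∂(gamma n (n - m) (Nat.sub_le n m)) = 0 := by
    have h1 : Tendsto (fun N : ℕ => C * (N + 1 : ℝ≥0∞)⁻¹) atTop (𝓝 0) := by
      simpa using ENNReal.Tendsto.const_mul hlim (Or.inr hC)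
    refine le_antisymm ((lintegral_liminf_le hfm).trans ?_) zero_le
    rw [← h1.liminf_eq]
    exact liminf_le_liminf (Eventually.of_forall hfi)
  rw [lintegral_eq_zero_iff (Measurable.liminf hfm)] at hint
  filter_upwards [hint] with V hV
  refine le_antisymm ?_ zero_le
  refine le_trans (Measure.hausdorffMeasure_le_liminf_tsum (t - m) _ _ hlim
    (fun N i => E N i ∩ (A ∩ (V.1 : Set (EuclideanSpace ℝ (Fin n)))))
    (Eventually.of_forall fun N i => (Metric.ediam_mono inter_subset_left).trans (hEd N i))
    (Eventually.of_forall fun N z hz => ?_)) (le_trans (liminf_le_liminf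
      (Eventually.of_forall fun N => ?_)) hV.le)
  · obtain ⟨i, hi⟩ := mem_iUnion.mp (hAE N hz.1)
    exact mem_iUnion.mpr ⟨i, hi, hz⟩
  · refine ENNReal.tsum_le_tsum fun i => ?_
    rcases (E N i ∩ (A ∩ (V.1 : Set (EuclideanSpace ℝ (Fin n))))).eq_empty_or_nonempty with h0 | h0
    · simp [h0, htm]
    · obtain ⟨z, hzE, hzA, hzV⟩ := h0
      have hne : (A ∩ E N i).Nonempty := ⟨z, hzA, hzE⟩
      have hmem : V ∈ T N i := by
        simp only [T, if_pos hne]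
        refine mem_tube_of_dist_le hzV ?_
        rw [dist_edist]
        exact ENNReal.toReal_mono (hfin N i) (Metric.edist_le_ediam_of_mem (hy N i hne).2 hzE)
      rw [indicator_of_mem hmem]
      exact ENNReal.rpow_le_rpow (Metric.ediam_mono inter_subset_left) htm.le

/-- The origin lies on every plane, so the tube estimate fails there; the countably many pieces `B
j` cover the rest of `A`, and one point has dimension zero. -/
theorem ae_dimH_inter_add_le {m : ℕ} (hm : m ≤ n) {A : Set (EuclideanSpace ℝ (Fin n))}
    {t : ℝ≥0} (ht : m < t) (h : dimH A < t) :
    ∀ᵐ V ∂(gamma n (n - m) (Nat.sub_le n m)),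
      dimH (A ∩ (V.1 : Set (EuclideanSpace ℝ (Fin n)))) + m ≤ t := by
  let B : ℕ → Set (EuclideanSpace ℝ (Fin n)) := fun j => {y ∈ A | (1 / (j + 1) : ℝ) ≤ ‖y‖}
  have hB : ∀ j, μH[(t : ℝ)] (B j) = 0 := fun j =>
    measure_mono_null (sep_subset _ _) (hausdorffMeasure_of_dimH_lt h)
  have hae := ae_all_iff.mpr fun j => ae_hausdorffMeasure_inter_eq_zero hm (A := B j)
    (δ := 1 / (j + 1)) (by positivity) (fun y hy => hy.2) (by exact_mod_cast ht) (hB j)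
  filter_upwards [hae] with V hV
  have hcast : (t : ℝ) - m = ((t - m : ℝ≥0) : ℝ) := by
    rw [NNReal.coe_sub ht.le, NNReal.coe_natCast]
  have hsub : A ∩ (V.1 : Set (EuclideanSpace ℝ (Fin n))) ⊆
      {0} ∪ ⋃ j, B j ∩ (V.1 : Set (EuclideanSpace ℝ (Fin n))) := by
    rintro z ⟨hzA, hzV⟩
    rcases eq_or_ne z 0 with rfl | hz
    · exact Or.inl rfl
    · obtain ⟨j, hj⟩ := exists_nat_one_div_lt (norm_pos_iff.mpr hz)
      exact Or.inr (mem_iUnion.mpr ⟨j, ⟨hzA, hj.le⟩, hzV⟩)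
  have hle : dimH (A ∩ (V.1 : Set (EuclideanSpace ℝ (Fin n)))) ≤ ((t - m : ℝ≥0) : ℝ≥0∞) := by
    refine (dimH_mono hsub).trans ?_
    rw [dimH_union, dimH_iUnion, dimH_singleton]
    refine max_le zero_le (iSup_le fun j => dimH_le_of_hausdorffMeasure_ne_top ?_)
    rw [← hcast, hV j]
    exact ENNReal.zero_ne_top
  calc _ ≤ ((t - m : ℝ≥0) : ℝ≥0∞) + ((m : ℝ≥0) : ℝ≥0∞) := by
        gcongr
        simp
    _ = t := by rw [← ENNReal.coe_add, tsub_add_cancel_of_le ht.le]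

theorem ae_dimH_inter_le {m : ℕ} (hm : m ≤ n) {A : Set (EuclideanSpace ℝ (Fin n))}
    (h : (m : ℝ≥0∞) < dimH A) :
    ∀ᵐ V ∂(gamma n (n - m) (Nat.sub_le n m)),
      dimH (A ∩ (V.1 : Set (EuclideanSpace ℝ (Fin n)))) ≤ dimH A - m := by
  rcases eq_or_ne (dimH A) ∞ with htop | htop
  · simp [htop]
  lift dimH A to ℝ≥0 using htop with s hs
  obtain ⟨u, -, hu, hlim⟩ := exists_seq_strictAnti_tendsto s
  have hms : (m : ℝ≥0) < s := by exact_mod_cast h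
  -- A sequence `u j` decreasing to `dimH A` keeps the exceptional set null; `m < dimH A` ensures `m
  -- < u j`.
  have hae := ae_all_iff.mpr fun j => ae_dimH_inter_add_le hm (hms.trans (hu j))
    (A := A) (by rw [← hs]; exact_mod_cast hu j)
  filter_upwards [hae] with V hV
  exact ENNReal.le_sub_of_add_le_right (ENNReal.natCast_ne_top m)
    (ge_of_tendsto (ENNReal.tendsto_coe.mpr hlim) (Eventually.of_forall hV))

end Grassmann

/-- If `A ⊆ ℝⁿ` is Borel with `dim A > m`, then for all `x`, `dim (A ∩ (V + x)) ≤ dim A - m` for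
`γ_{n,n-m}`-almost all `V ∈ G(n,n-m)`. -/
theorem mainTheorem8 (n m : ℕ) (hm : m ≤ n) (A : Set (EuclideanSpace ℝ (Fin n)))
    (hA : MeasurableSet A) (hdim : (m : ENNReal) < dimH A) (x : EuclideanSpace ℝ (Fin n)) :
    ∀ᵐ V ∂(Grassmann.gamma n (n - m) (Nat.sub_le n m)),
      dimH (A ∩ ((fun v => v + x) '' (V.1 : Set (EuclideanSpace ℝ (Fin n))))) ≤ dimH A - m := by
  set A' := (fun v => v + x) ⁻¹' A
  have hiso : Isometry fun v : EuclideanSpace ℝ (Fin n) => v + x := isometry_add_right x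
  have hinter : ∀ S : Set (EuclideanSpace ℝ (Fin n)),
      dimH (A ∩ (fun v => v + x) '' S) = dimH (A' ∩ S) := fun S => by
    rw [← hiso.dimH_image (A' ∩ S), image_preimage_inter]
  have hA' : dimH A' = dimH A := by
    rw [← hiso.dimH_image A', image_preimage_eq _ (add_right_surjective x)]
  rw [← hA'] at hdim ⊢
  simp only [hinter]
  exact Grassmann.ae_dimH_inter_le hm hdim
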